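/- Consider the single-input linear system $\dot x(t)=Ax(t)+Bu(t)$ with $A\in\mathbb R^{n\times n}$, $B\in\mathbb R^{n\times 1}$, and fix $T>0$. Let $0\le U_1<U_2<\dots<U_N=1$ ($N\ge 1$) and let $w_1,\dots,w_N\ge 0$ be weights with $w_1+\dots+w_N=1$. For measurable $u:[0,T]\to\mathbb R$ put $\|u\|_1=\int_0^T|u(t)|\,dt$, $\|u\|_\infty=\operatorname{ess\,sup}_{t\in[0,T]}|u(t)|$, and $$J(u)=\sum_{i=1}^N w_i\bigl(\|u-U_i\|_1+\|u+U_i\|_1\bigr).$$ For $\xi\in\mathbb R^n$ let $\mathcal U(\xi)$ be the set of measurable controls $u$ on $[0,T]$ with $\|u\|_\infty\le 1$ that steer the system from $x(0)=\xi$ to $x(T)=0$, and let $$\mathcal R=\Bigl\{\int_0^T e^{-At}Bu(t)\,dt:\ u \text{ measurable},\ \|u\|_\infty\le 1\Bigr\}$$ be the reachable set. If the pair $(A,B)$ is controllable, then for every $\xi\in\mathcal R$ the minimum $$V(\xi)=\min\{J(u):u\in\mathcal U(\xi)\}$$ exists, and the value function $V$ is continuous on $\mathcal R$. -/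

import Mathlib

open MeasureTheory Set
open scoped Matrix ENNReal

noncomputable section

/-- `x` is a (Carathéodory) solution on `[0, τ]` of the single-input linear system
`x'(t) = A x(t) + B u(t)` driven by the integrable control `u`: it is continuous and satisfies
the equation in integrated form. -/
def IsTrajectory {n : ℕ} (A : Matrix (Fin n) (Fin n) ℝ) (B : Fin n → ℝ) (τ : ℝ)
    (u : ℝ → ℝ) (x : ℝ → Fin n → ℝ) : Prop :=
  IntervalIntegrable u volume 0 τ ∧ ContinuousOn x (Icc 0 τ) ∧
    ∀ t ∈ Icc 0 τ, x t = x 0 + ∫ s in (0 : ℝ)..t, (A *ᵥ x s + u s • B)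

/-- The pair `(A, B)` is controllable: every state can be steered to every other state in some
finite time by some control. -/
def Controllable {n : ℕ} (A : Matrix (Fin n) (Fin n) ℝ) (B : Fin n → ℝ) : Prop :=
  ∀ x₀ x₁ : Fin n → ℝ, ∃ τ : ℝ, 0 < τ ∧ ∃ (u : ℝ → ℝ) (x : ℝ → Fin n → ℝ),
    IsTrajectory A B τ u x ∧ x 0 = x₀ ∧ x τ = x₁

/-- Measurable controls on `[0, T]` with `‖u‖_∞ ≤ 1`. -/
def admissibleControls (T : ℝ) : Set (ℝ → ℝ) :=
  {u | AEStronglyMeasurable u (volume.restrict (Icc 0 T)) ∧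
    eLpNorm u ∞ (volume.restrict (Icc 0 T)) ≤ 1}

/-- The set `𝒰(ξ)` of feasible controls: those with `‖u‖_∞ ≤ 1` which steer the state from
`x(0) = ξ` to `x(T) = 0`. -/
def feasibleControls {n : ℕ} (A : Matrix (Fin n) (Fin n) ℝ) (B : Fin n → ℝ) (T : ℝ)
    (ξ : Fin n → ℝ) : Set (ℝ → ℝ) :=
  {u | u ∈ admissibleControls T ∧
    ∃ x : ℝ → Fin n → ℝ, IsTrajectory A B T u x ∧ x 0 = ξ ∧ x T = 0}

/-- The reachable set `ℛ = {∫₀ᵀ e^{-At} B u(t) dt : ‖u‖_∞ ≤ 1}`. -/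
def reachableSet {n : ℕ} (A : Matrix (Fin n) (Fin n) ℝ) (B : Fin n → ℝ) (T : ℝ) :
    Set (Fin n → ℝ) :=
  {ξ | ∃ u ∈ admissibleControls T,
    ξ = ∫ t in (0 : ℝ)..T, u t • (NormedSpace.exp (-(t • A)) *ᵥ B)}

/-- The norm `‖v‖₁ = ∫₀ᵀ |v(t)| dt`. -/
def l1Norm (T : ℝ) (v : ℝ → ℝ) : ℝ :=
  ∫ t in (0 : ℝ)..T, |v t|

/-- The sum-of-absolute-values cost `J(u) = ∑ᵢ wᵢ (‖u - Uᵢ‖₁ + ‖u + Uᵢ‖₁)`. -/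
def soavCost {N : ℕ} (U w : Fin N → ℝ) (T : ℝ) (u : ℝ → ℝ) : ℝ :=
  ∑ i, w i * (l1Norm T (fun t => u t - U i) + l1Norm T (fun t => u t + U i))

/-- The optimal value `V(ξ)` of the cost `J` over the feasible controls. -/
def valueFunction {n N : ℕ} (A : Matrix (Fin n) (Fin n) ℝ) (B : Fin n → ℝ)
    (U w : Fin N → ℝ) (T : ℝ) (ξ : Fin n → ℝ) : ℝ :=
  sInf (soavCost U w T '' feasibleControls A B T ξ)

end

/-
Identify the controls bounded by `1` with a bounded closed convex subset of `L²(0, T)`, which is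
weakly compact. The control-to-initial-state map is linear and weakly continuous, and the cost is
convex and continuous, hence weakly lower semicontinuous; so the minimum exists and `V` is convex
and lower semicontinuous on `ℛ`. In the relative interior of `ℛ` a convex function is continuous.
Any other point `ξ` of `ℛ` has a supporting functional `f` which is not constant on `ℛ`. Then
`t ↦ f (e^{-tA} B)` is analytic and not identically zero, so it vanishes only on a null set, and
every control reaching `ξ` has to be bang-bang. Now `J u = ∫ φ (u t)` with `φ` convex and even, so
`φ ≤ φ 1` on `[-1, 1]` and bang-bang controls maximize `J` among the controls bounded by `1`.
Hence `V` attains its maximum at `ξ` and is upper semicontinuous there.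
-/
section ProperSupport

variable {F : Type*} [NormedAddCommGroup F] [NormedSpace ℝ F]

/-- `f` supports `C` at `x` nontrivially, in Rockafellar's sense: it is maximal over `C` at `x` and
is not constant on `C`. -/
def IsProperSupport (f : F →L[ℝ] ℝ) (C : Set F) (x : F) : Prop :=
  IsMaxOn f C x ∧ ∃ y ∈ C, f y ≠ f x

variable {C : Set F} {x : F}

theorem intrinsicInterior_eq_image_interior_preimage (hx : x ∈ C) :
    intrinsicInterior ℝ C = (fun w : (affineSpan ℝ C).direction => x + w) ''
      interior ((fun w : (affineSpan ℝ C).direction => x + w) ⁻¹' C) := by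
  have hxS : x ∈ affineSpan ℝ C := subset_affineSpan ℝ C hx
  have : Nonempty (affineSpan ℝ C) := ⟨⟨x, hxS⟩⟩
  let e := (IsometryEquiv.vaddConst (⟨x, hxS⟩ : affineSpan ℝ C)).toHomeomorph
  have he : (fun w : (affineSpan ℝ C).direction => x + w) = (↑) ∘ e :=
    funext fun w => add_comm x w
  rw [he, preimage_comp, ← e.preimage_interior, image_comp, e.image_preimage, intrinsicInterior]

theorem exists_isProperSupport_of_notMem_intrinsicInterior [FiniteDimensional ℝ F]
    (hC : Convex ℝ C) (hx : x ∈ C) (hxC : x ∉ intrinsicInterior ℝ C) :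
    ∃ f : F →L[ℝ] ℝ, IsProperSupport f C x := by
  set W := (affineSpan ℝ C).direction
  set D : Set W := (fun w : W => x + w) ⁻¹' C
  have hint : intrinsicInterior ℝ C = (fun w : W => x + w) '' interior D :=
    intrinsicInterior_eq_image_interior_preimage hx
  have hD : Convex ℝ D := (hC.translate_preimage_right x).linear_preimage W.subtype
  have hDint : (interior D).Nonempty := by
    rw [← image_nonempty, ← hint]
    exact Set.Nonempty.intrinsicInterior hC ⟨x, hx⟩
  have h0 : (0 : W) ∉ interior D := fun h => hxC (hint ▸ ⟨0, h, add_zero x⟩)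
  obtain ⟨f, hf, hfD⟩ := geometric_hahn_banach_of_nonempty_interior_point hD h0 hDint
  obtain ⟨g, hg, -⟩ := exists_extension_norm_eq W f
  have hmemW : ∀ y ∈ C, y - x ∈ W := fun y hy =>
    AffineSubspace.vsub_mem_direction (subset_affineSpan ℝ C hy) (subset_affineSpan ℝ C hx)
  refine ⟨g, fun y hy => ?_, ?_⟩
  · have := hfD ⟨y - x, hmemW y hy⟩ (by simpa [D] using hy)
    rw [← hg, map_zero, map_sub] at this
    exact sub_nonpos.1 this
  · by_contra! hconst
    refine hf (ContinuousLinearMap.ext fun w => ?_)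
    have hker : (f : W →ₗ[ℝ] ℝ).ker = ⊤ :=
      Submodule.eq_top_of_nonempty_interior' _ (hDint.mono (interior_mono fun w hw => ?_))
    · exact LinearMap.mem_ker.1 (hker ▸ Submodule.mem_top : w ∈ (f : W →ₗ[ℝ] ℝ).ker)
    · have := hconst _ hw
      rw [map_add, hg] at this
      exact add_eq_left.1 this

theorem continuousWithinAt_of_mem_intrinsicInterior [FiniteDimensional ℝ F] {V : F → ℝ}
    (hV : ConvexOn ℝ C V) (hx : x ∈ intrinsicInterior ℝ C) : ContinuousWithinAt V C x := by
  have hxC : x ∈ C := intrinsicInterior_subset hx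
  set W := (affineSpan ℝ C).direction
  let ψ : W → F := fun w => x + w
  have hψ : Topology.IsEmbedding ψ :=
    (Homeomorph.addLeft x).isEmbedding.comp Topology.IsEmbedding.subtypeVal
  have hψC : C = ψ '' (ψ ⁻¹' C) := by
    refine (image_preimage_eq_of_subset fun y hy => ?_).symm
    have : y - x ∈ W :=
      AffineSubspace.vsub_mem_direction (subset_affineSpan ℝ C hy) (subset_affineSpan ℝ C hxC)
    exact ⟨⟨y - x, this⟩, add_sub_cancel x y⟩
  have hVψ : ConvexOn ℝ (ψ ⁻¹' C) (V ∘ ψ) :=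
    (hV.translate_right x).comp_linearMap W.subtype
  have h0 : (0 : W) ∈ interior (ψ ⁻¹' C) := by
    rw [intrinsicInterior_eq_image_interior_preimage hxC] at hx
    obtain ⟨w, hw, hwx⟩ := hx
    rwa [show w = 0 by simpa using hwx] at hw
  have hcont : ContinuousAt (V ∘ ψ) 0 :=
    (hVψ.continuousOn_interior 0 h0).continuousAt (isOpen_interior.mem_nhds h0)
  have hψ0 : ψ 0 = x := add_zero x
  rw [ContinuousWithinAt, hψC, ← hψ0, ← hψ.isInducing.map_nhdsWithin_eq, Filter.tendsto_map'_iff]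
  exact hcont.continuousWithinAt

end ProperSupport

section OptimalValue

/-- The optimal value of the program of minimizing `J u` over the `u ∈ K` with `Φ u = ξ`. It is
meaningful for `ξ ∈ Φ '' K`. -/
noncomputable def optimalValue {E F : Type*} (K : Set E) (Φ : E → F) (J : E → ℝ) (ξ : F) : ℝ :=
  sInf (J '' (K ∩ Φ ⁻¹' {ξ}))

section Topological

variable {E F : Type*} [TopologicalSpace E] [TopologicalSpace F] [T2Space F]
  {K : Set E} {Φ : E → F} {J : E → ℝ}

theorem isLeast_optimalValue (hK : IsCompact K) (hΦ : ContinuousOn Φ K)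
    (hJ : LowerSemicontinuousOn J K) {ξ : F} (hξ : ξ ∈ Φ '' K) :
    IsLeast (J '' (K ∩ Φ ⁻¹' {ξ})) (optimalValue K Φ J ξ) := by
  have hfibre : IsCompact (K ∩ Φ ⁻¹' {ξ}) := by
    obtain ⟨Z, hZ, hKZ⟩ := continuousOn_iff_isClosed.1 hΦ {ξ} isClosed_singleton
    rw [inter_comm, hKZ, inter_comm]
    exact hK.inter_right hZ
  obtain ⟨u, hu, hmin⟩ := (hJ.mono inter_subset_left).exists_isMinOn
    (s := K ∩ Φ ⁻¹' {ξ}) hξ hfibre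
  have hleast : IsLeast (J '' (K ∩ Φ ⁻¹' {ξ})) (J u) :=
    ⟨mem_image_of_mem J hu, forall_mem_image.2 hmin⟩
  rwa [optimalValue, hleast.csInf_eq]

theorem lowerSemicontinuousOn_optimalValue (hK : IsCompact K) (hΦ : ContinuousOn Φ K)
    (hJ : LowerSemicontinuousOn J K) :
    LowerSemicontinuousOn (optimalValue K Φ J) (Φ '' K) := by
  refine lowerSemicontinuousOn_iff_preimage_Iic.2 fun c => ⟨Φ '' (K ∩ J ⁻¹' Iic c), ?_, ?_⟩
  · exact ((hJ.isCompact_inter_preimage_Iic hK c).image_of_continuousOn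
      (hΦ.mono inter_subset_left)).isClosed
  · ext ξ
    refine and_congr_right fun hξ => ?_
    obtain ⟨⟨u, ⟨hu, hΦu⟩, hJu⟩, hle⟩ := isLeast_optimalValue hK hΦ hJ hξ
    constructor
    · exact fun hc => ⟨u, ⟨hu, hJu.trans_le hc⟩, hΦu⟩
    · rintro ⟨v, ⟨hv, hJv⟩, hΦv⟩
      exact (hle ⟨v, ⟨hv, hΦv⟩, rfl⟩).trans hJv

end Topological

variable {E F : Type*} [AddCommGroup E] [Module ℝ E] [TopologicalSpace E]
  [NormedAddCommGroup F] [NormedSpace ℝ F]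
  {K : Set E} {Φ : E →ₗ[ℝ] F} {J : E → ℝ}

theorem convexOn_optimalValue (hK : IsCompact K) (hΦ : ContinuousOn Φ K)
    (hJ : LowerSemicontinuousOn J K) (hJK : ConvexOn ℝ K J) :
    ConvexOn ℝ (Φ '' K) (optimalValue K Φ J) := by
  refine ⟨hJK.1.linear_image Φ, fun ξ hξ ζ hζ a b ha hb hab => ?_⟩
  obtain ⟨u, ⟨hu, rfl⟩, hJu⟩ := (isLeast_optimalValue hK hΦ hJ hξ).1
  obtain ⟨v, ⟨hv, rfl⟩, hJv⟩ := (isLeast_optimalValue hK hΦ hJ hζ).1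
  have huv : a • u + b • v ∈ K := hJK.1 hu hv ha hb hab
  have hΦuv : Φ (a • u + b • v) = a • Φ u + b • Φ v := by
    rw [map_add, map_smul, map_smul]
  rw [← hJu, ← hJv, ← hΦuv]
  calc optimalValue K Φ J (Φ (a • u + b • v)) ≤ J (a • u + b • v) :=
        (isLeast_optimalValue hK hΦ hJ (mem_image_of_mem Φ huv)).2 ⟨_, ⟨huv, rfl⟩, rfl⟩
    _ ≤ a • J u + b • J v := hJK.2 hu hv ha hb hab

theorem continuousOn_optimalValue [FiniteDimensional ℝ F] (hK : IsCompact K)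
    (hΦ : ContinuousOn Φ K) (hJ : LowerSemicontinuousOn J K) (hJK : ConvexOn ℝ K J)
    (hmax : ∀ u ∈ K, ∀ f : F →L[ℝ] ℝ, IsProperSupport f (Φ '' K) (Φ u) → IsMaxOn J K u) :
    ContinuousOn (optimalValue K Φ J) (Φ '' K) := by
  intro ξ hξ
  by_cases hint : ξ ∈ intrinsicInterior ℝ (Φ '' K)
  · exact continuousWithinAt_of_mem_intrinsicInterior (convexOn_optimalValue hK hΦ hJ hJK) hint
  obtain ⟨f, hf⟩ :=
    exists_isProperSupport_of_notMem_intrinsicInterior (hJK.1.linear_image Φ) hξ hint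
  obtain ⟨u, ⟨hu, hΦu⟩, hJu⟩ := (isLeast_optimalValue hK hΦ hJ hξ).1
  have hVmax : IsMaxOn (optimalValue K Φ J) (Φ '' K) ξ := fun ζ hζ => by
    obtain ⟨v, ⟨hv, -⟩, hJv⟩ := (isLeast_optimalValue hK hΦ hJ hζ).1
    rw [mem_ofPred_eq, ← hJu, ← hJv]
    exact hmax u hu f (by rwa [hΦu]) hv
  refine continuousWithinAt_iff_lower_upperSemicontinuousWithinAt.2
    ⟨lowerSemicontinuousOn_optimalValue hK hΦ hJ ξ hξ, fun c hc => ?_⟩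
  filter_upwards [self_mem_nhdsWithin] with ζ hζ using (hVmax hζ).trans_lt hc

end OptimalValue

section WeakTopology

variable {H : Type*} [NormedAddCommGroup H]

theorem isClosed_toWeakSpace_image [NormedSpace ℝ H] {K : Set H} (hKcv : Convex ℝ K)
    (hKcl : IsClosed K) : IsClosed (toWeakSpace ℝ H '' K) := by
  rw [← hKcl.closure_eq, hKcv.toWeakSpace_closure ℝ]
  exact isClosed_closure

theorem isCompact_toWeakSpace_closedBall [InnerProductSpace ℝ H] [CompleteSpace H] (r : ℝ) :
    IsCompact (toWeakSpace ℝ H '' Metric.closedBall 0 r) := by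
  let e : WeakDual ℝ H → WeakSpace ℝ H := fun f =>
    toWeakSpace ℝ H ((InnerProductSpace.toDual ℝ H).symm (WeakDual.toStrongDual f))
  have he : Continuous e := by
    refine WeakBilin.continuous_of_continuous_eval _ fun g => ?_
    have hswap (f : WeakDual ℝ H) : g ((InnerProductSpace.toDual ℝ H).symm f.toStrongDual)
        = f ((InnerProductSpace.toDual ℝ H).symm g) := by
      rw [← InnerProductSpace.toDual_symm_apply, real_inner_comm,
        InnerProductSpace.toDual_symm_apply, WeakDual.toStrongDual_apply]
    exact (WeakDual.eval_continuous _).congr fun f => (hswap f).symm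
  convert (WeakDual.isCompact_closedBall (0 : StrongDual ℝ H) r).image he using 1
  rw [show e = toWeakSpace ℝ H ∘ (InnerProductSpace.toDual ℝ H).symm ∘ WeakDual.toStrongDual
    from rfl, image_comp, image_comp, image_preimage_eq _ WeakDual.toStrongDual.surjective,
    LinearIsometryEquiv.image_closedBall, map_zero]

theorem isCompact_toWeakSpace_image [InnerProductSpace ℝ H] [CompleteSpace H] {K : Set H}
    (hKcv : Convex ℝ K) (hKcl : IsClosed K) (hKbd : Bornology.IsBounded K) :
    IsCompact (toWeakSpace ℝ H '' K) := by
  obtain ⟨r, hr⟩ := hKbd.subset_closedBall 0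
  exact (isCompact_toWeakSpace_closedBall r).of_isClosed_subset
    (isClosed_toWeakSpace_image hKcv hKcl) (image_mono hr)

theorem lowerSemicontinuousOn_comp_toWeakSpace_symm [NormedSpace ℝ H] {K : Set H} {J : H → ℝ}
    (hKcl : IsClosed K) (hJ : ConvexOn ℝ K J) (hJc : LowerSemicontinuousOn J K) :
    LowerSemicontinuousOn (J ∘ (toWeakSpace ℝ H).symm) (toWeakSpace ℝ H '' K) := by
  refine lowerSemicontinuousOn_iff_preimage_Iic.2 fun c =>
    ⟨toWeakSpace ℝ H '' (K ∩ J ⁻¹' Iic c), isClosed_toWeakSpace_image (hJ.convex_le c) ?_, ?_⟩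
  · obtain ⟨Z, hZ, hKZ⟩ := lowerSemicontinuousOn_iff_preimage_Iic.1 hJc c
    exact hKZ ▸ hKcl.inter hZ
  · ext v
    constructor
    · rintro ⟨⟨u, hu, rfl⟩, hJu⟩
      exact ⟨mem_image_of_mem _ hu, u, ⟨hu, by simpa using hJu⟩, rfl⟩
    · rintro ⟨hv, u, ⟨-, hJu⟩, rfl⟩
      exact ⟨hv, by simpa using hJu⟩

theorem continuous_comp_toWeakSpace_symm [NormedSpace ℝ H] {F : Type*} [NormedAddCommGroup F]
    [NormedSpace ℝ F] [FiniteDimensional ℝ F] (Φ : H →L[ℝ] F) :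
    Continuous (Φ.toLinearMap ∘ₗ (toWeakSpace ℝ H).symm.toLinearMap) := by
  have : FiniteDimensional ℝ (WeakSpace ℝ F) := (toWeakSpace ℝ F).finiteDimensional
  exact (toWeakSpace ℝ F).symm.toLinearMap.continuous_of_finiteDimensional.comp
    (WeakSpace.map Φ).continuous

end WeakTopology

section HilbertProgram

variable {H F : Type*} [NormedAddCommGroup H] [InnerProductSpace ℝ H] [CompleteSpace H]
  [NormedAddCommGroup F] [NormedSpace ℝ F] [FiniteDimensional ℝ F]
  {K : Set H} {Φ : H →L[ℝ] F} {J : H → ℝ}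

theorem image_comp_symm_image_inter_preimage {E E' F G : Type*} (e : E ≃ E') (K : Set E)
    (Φ : E → F) (J : E → G) (S : Set F) :
    (J ∘ e.symm) '' (e '' K ∩ (Φ ∘ e.symm) ⁻¹' S) = J '' (K ∩ Φ ⁻¹' S) := by
  rw [image_comp, e.image_eq_preimage_symm K, preimage_comp, ← preimage_inter,
    e.symm.image_preimage]

theorem optimalValue_image_equiv {E E' F : Type*} (e : E ≃ E') (K : Set E) (Φ : E → F)
    (J : E → ℝ) :
    optimalValue (e '' K) (Φ ∘ e.symm) (J ∘ e.symm) = optimalValue K Φ J :=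
  funext fun ξ => congrArg sInf (image_comp_symm_image_inter_preimage e K Φ J {ξ})

theorem isLeast_optimalValue_of_isBounded (hKcl : IsClosed K)
    (hKbd : Bornology.IsBounded K) (hJ : ConvexOn ℝ K J) (hJc : LowerSemicontinuousOn J K)
    {ξ : F} (hξ : ξ ∈ Φ '' K) :
    IsLeast (J '' (K ∩ Φ ⁻¹' {ξ})) (optimalValue K Φ J ξ) := by
  let e := (toWeakSpace ℝ H).toEquiv
  rw [← image_comp_symm_image_inter_preimage e, ← optimalValue_image_equiv e]
  exact isLeast_optimalValue (isCompact_toWeakSpace_image hJ.1 hKcl hKbd)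
    (continuous_comp_toWeakSpace_symm Φ).continuousOn
    (lowerSemicontinuousOn_comp_toWeakSpace_symm hKcl hJ hJc)
    (by simpa [image_image] using hξ)

theorem continuousOn_optimalValue_of_isBounded (hKcl : IsClosed K)
    (hKbd : Bornology.IsBounded K) (hJ : ConvexOn ℝ K J) (hJc : LowerSemicontinuousOn J K)
    (hmax : ∀ u ∈ K, ∀ f : F →L[ℝ] ℝ, IsProperSupport f (Φ '' K) (Φ u) → IsMaxOn J K u) :
    ContinuousOn (optimalValue K Φ J) (Φ '' K) := by
  set e := toWeakSpace ℝ H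
  have himage : (Φ.toLinearMap ∘ₗ e.symm.toLinearMap) '' (e '' K) = Φ '' K := by
    simp [image_image]
  have hJe : ConvexOn ℝ (e '' K) (J ∘ e.symm) := by
    rw [e.image_eq_preimage_symm]
    exact hJ.comp_linearMap e.symm.toLinearMap
  have hvalue : optimalValue (e '' K) (Φ.toLinearMap ∘ₗ e.symm.toLinearMap) (J ∘ e.symm) =
      optimalValue K Φ J := optimalValue_image_equiv e.toEquiv K Φ J
  rw [← hvalue, ← himage]
  refine continuousOn_optimalValue (isCompact_toWeakSpace_image hJ.1 hKcl hKbd)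
    (continuous_comp_toWeakSpace_symm Φ).continuousOn
    (lowerSemicontinuousOn_comp_toWeakSpace_symm hKcl hJ hJc) hJe ?_
  rintro _ ⟨u, hu, rfl⟩ f hf _ ⟨v, hv, rfl⟩
  rw [himage] at hf
  simpa using hmax u hu f (by simpa using hf) hv

end HilbertProgram

section UnitControls

variable {α : Type*} [MeasurableSpace α] {μ : Measure α}

/-- The classes in `L²(μ)` of controls with `‖u‖_∞ ≤ 1`. -/
def unitControls (μ : Measure α) : Set (Lp ℝ 2 μ) :=
  {u | ∀ᵐ t ∂μ, |u t| ≤ 1}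

theorem neg_mem_unitControls {u : Lp ℝ 2 μ} (hu : u ∈ unitControls μ) : -u ∈ unitControls μ := by
  filter_upwards [hu, Lp.coeFn_neg u] with t ht hneg
  rwa [hneg, Pi.neg_apply, abs_neg]

theorem convex_unitControls : Convex ℝ (unitControls μ) := by
  intro u hu v hv a b ha hb hab
  filter_upwards [hu, hv, Lp.coeFn_add (a • u) (b • v), Lp.coeFn_smul a u, Lp.coeFn_smul b v]
    with t hut hvt hadd hsmul_u hsmul_v
  rw [hadd, Pi.add_apply, hsmul_u, hsmul_v, abs_le]
  exact convex_Icc (-1) 1 (abs_le.1 hut) (abs_le.1 hvt) ha hb hab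

variable [IsFiniteMeasure μ]

theorem unitControls_eq_Icc : unitControls μ = Icc (-Lp.const 2 μ 1) (Lp.const 2 μ 1) := by
  ext u
  rw [mem_Icc, ← Lp.coeFn_le, ← Lp.coeFn_le, Filter.EventuallyLE, Filter.EventuallyLE,
    ← Filter.eventually_and, unitControls, mem_ofPred_eq]
  refine Filter.eventually_congr ?_
  filter_upwards [Lp.coeFn_const (μ := μ) (p := 2) (1 : ℝ), Lp.coeFn_neg (Lp.const 2 μ (1 : ℝ))]
    with t hconst hneg
  rw [hneg, Pi.neg_apply, hconst, abs_le, Function.const_apply]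

theorem isClosed_unitControls : IsClosed (unitControls μ) := by
  rw [unitControls_eq_Icc]
  exact isClosed_Icc

theorem isBounded_unitControls : Bornology.IsBounded (unitControls μ) := by
  refine isBounded_iff_forall_norm_le.2 ⟨‖Lp.const 2 μ (1 : ℝ)‖, fun u hu => ?_⟩
  refine Lp.norm_le_norm_of_ae_le ?_
  filter_upwards [hu, Lp.coeFn_const (μ := μ) (p := 2) (1 : ℝ)] with t ht hconst
  rw [hconst]
  simpa using ht

theorem exists_mem_unitControls_ae_eq {v : α → ℝ} (hv : AEStronglyMeasurable v μ)
    (hv1 : ∀ᵐ t ∂μ, |v t| ≤ 1) : ∃ u ∈ unitControls μ, u =ᵐ[μ] v := by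
  have hLp : MemLp v 2 μ := MemLp.of_bound hv 1 hv1
  refine ⟨hLp.toLp v, ?_, hLp.coeFn_toLp⟩
  filter_upwards [hv1, hLp.coeFn_toLp] with t ht heq
  rwa [heq]

theorem exists_mem_unitControls_mul_eq_abs {h : α → ℝ} (hh : AEStronglyMeasurable h μ) :
    ∃ u ∈ unitControls μ, ∀ᵐ t ∂μ, u t * h t = |h t| := by
  have hsign : Measurable fun s : ℝ => if 0 ≤ s then (1 : ℝ) else -1 :=
    measurable_const.ite measurableSet_Ici measurable_const
  obtain ⟨u, hu, hae⟩ := exists_mem_unitControls_ae_eq (μ := μ)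
    (v := fun t => if 0 ≤ h t then 1 else -1)
    (hsign.comp_aemeasurable hh.aemeasurable).aestronglyMeasurable
    (Filter.Eventually.of_forall fun t => by split_ifs <;> simp)
  refine ⟨u, hu, ?_⟩
  filter_upwards [hae] with t ht
  rw [ht]
  split_ifs with h0
  · rw [one_mul, abs_of_nonneg h0]
  · rw [neg_one_mul, abs_of_neg (not_le.1 h0)]

end UnitControls

section MomentMap

variable {α F : Type*} [MeasurableSpace α] {μ : Measure α}
  [NormedAddCommGroup F] [NormedSpace ℝ F] {g : α → F}

/-- The kernel `g` is normal if no functional vanishes along it on a set of positive measure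
without vanishing along it almost everywhere. -/
def IsNormalKernel (g : α → F) (μ : Measure α) : Prop :=
  ∀ f : F →L[ℝ] ℝ, (∀ᵐ t ∂μ, f (g t) = 0) ∨ ∀ᵐ t ∂μ, f (g t) ≠ 0

theorem integrable_smul_of_memLp_two (hg : MemLp g 2 μ) (u : Lp ℝ 2 μ) :
    Integrable (fun t => u t • g t) μ :=
  memLp_one_iff_integrable.1 (hg.smul (Lp.memLp u))

variable [CompleteSpace F]

/-- The moment map `u ↦ ∫ u g dμ` of a square-integrable vector-valued kernel `g`. -/
noncomputable def momentMap (hg : MemLp g 2 μ) : Lp ℝ 2 μ →L[ℝ] F :=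
  ((ContinuousLinearMap.lsmul ℝ ℝ : ℝ →L[ℝ] F →L[ℝ] F).lpPairing μ 2 2).flip (hg.toLp g)

theorem momentMap_apply (hg : MemLp g 2 μ) (u : Lp ℝ 2 μ) :
    momentMap hg u = ∫ t, u t • g t ∂μ := by
  rw [momentMap, ContinuousLinearMap.flip_apply, ContinuousLinearMap.lpPairing_eq_integral]
  refine integral_congr_ae ?_
  filter_upwards [hg.coeFn_toLp] with t ht
  rw [ht, ContinuousLinearMap.lsmul_apply]

theorem apply_momentMap (hg : MemLp g 2 μ) (u : Lp ℝ 2 μ) (f : F →L[ℝ] ℝ) :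
    f (momentMap hg u) = ∫ t, u t * f (g t) ∂μ := by
  rw [momentMap_apply, ← f.integral_comp_comm (integrable_smul_of_memLp_two hg u)]
  simp only [map_smul, smul_eq_mul]

theorem ae_mul_eq_abs_of_isMaxOn [IsFiniteMeasure μ] (hg : MemLp g 2 μ)
    {u : Lp ℝ 2 μ} (hu : u ∈ unitControls μ) {f : F →L[ℝ] ℝ}
    (hf : IsMaxOn f (momentMap hg '' unitControls μ) (momentMap hg u)) :
    ∀ᵐ t ∂μ, u t * f (g t) = |f (g t)| := by
  obtain ⟨v, hv, hvabs⟩ :=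
    exists_mem_unitControls_mul_eq_abs (f.continuous.comp_aestronglyMeasurable hg.1)
  have hle : ∀ᵐ t ∂μ, u t * f (g t) ≤ v t * f (g t) := by
    filter_upwards [hu, hvabs] with t ht hvt
    calc u t * f (g t) ≤ |u t| * |f (g t)| := by rw [← abs_mul]; exact le_abs_self _
      _ ≤ v t * f (g t) := by
        rw [hvt]
        exact mul_le_of_le_one_left (abs_nonneg _) ht
  have hint (w : Lp ℝ 2 μ) : Integrable (fun t => w t * f (g t)) μ := by
    simpa using f.integrable_comp (integrable_smul_of_memLp_two hg w)
  have hge : ∫ t, v t * f (g t) ∂μ ≤ ∫ t, u t * f (g t) ∂μ := by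
    rw [← apply_momentMap hg, ← apply_momentMap hg]
    exact hf (mem_image_of_mem _ hv)
  have heq := (integral_eq_iff_of_ae_le (hint u) (hint v) hle).1
    ((integral_mono_ae (hint u) (hint v) hle).antisymm hge)
  exact heq.trans hvabs

theorem ae_abs_eq_one_of_isProperSupport [IsFiniteMeasure μ]
    (hg : MemLp g 2 μ) (hnormal : IsNormalKernel g μ) {u : Lp ℝ 2 μ} (hu : u ∈ unitControls μ)
    {f : F →L[ℝ] ℝ} (hf : IsProperSupport f (momentMap hg '' unitControls μ) (momentMap hg u)) :
    ∀ᵐ t ∂μ, |u t| = 1 := by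
  obtain ⟨hmax, _, ⟨v, -, rfl⟩, hne⟩ := hf
  have hfg : ∀ᵐ t ∂μ, f (g t) ≠ 0 := by
    refine (hnormal f).resolve_left fun hzero => hne ?_
    have hvanish (w : Lp ℝ 2 μ) : f (momentMap hg w) = 0 := by
      rw [apply_momentMap]
      refine integral_eq_zero_of_ae ?_
      filter_upwards [hzero] with t ht
      rw [ht, mul_zero, Pi.zero_apply]
    rw [hvanish, hvanish]
  filter_upwards [ae_mul_eq_abs_of_isMaxOn hg hu hmax, hfg] with t ht hne
  have habs : |u t| * |f (g t)| = |f (g t)| := by rw [← abs_mul, ht, abs_abs]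
  exact (mul_eq_right₀ (abs_ne_zero.2 hne)).1 habs

end MomentMap

section IntegralCost

variable {α : Type*} [MeasurableSpace α] {μ : Measure α} [IsFiniteMeasure μ] {φ : ℝ → ℝ}

theorem integral_abs_le_norm_const_mul_norm (u : Lp ℝ 2 μ) :
    ∫ t, |u t| ∂μ ≤ ‖Lp.const 2 μ (1 : ℝ)‖ * ‖u‖ := by
  have hinner : ∫ t, |u t| ∂μ = inner ℝ (Lp.const 2 μ (1 : ℝ)) |u| := by
    rw [L2.inner_def]
    refine integral_congr_ae ?_
    filter_upwards [Lp.coeFn_const (μ := μ) (p := 2) (1 : ℝ), Lp.coeFn_abs u] with t hconst habs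
    rw [hconst, habs]
    simp
  rw [hinner, ← norm_abs_eq_norm u]
  exact real_inner_le_norm _ _

theorem integrable_comp_of_mem_unitControls (hφ : Continuous φ) {u : Lp ℝ 2 μ}
    (hu : u ∈ unitControls μ) : Integrable (fun t => φ (u t)) μ := by
  obtain ⟨c, hc⟩ := isCompact_Icc.exists_bound_of_continuousOn (s := Icc (-1) 1) hφ.continuousOn
  refine Integrable.of_bound (hφ.comp_aestronglyMeasurable (Lp.aestronglyMeasurable u)) c ?_
  filter_upwards [hu] with t ht using hc _ (abs_le.1 ht)

theorem convexOn_integral_comp (hφ : ConvexOn ℝ univ φ) :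
    ConvexOn ℝ (unitControls μ) fun u => ∫ t, φ (u t) ∂μ := by
  have hint {u : Lp ℝ 2 μ} (hu : u ∈ unitControls μ) : Integrable (fun t => φ (u t)) μ :=
    integrable_comp_of_mem_unitControls hφ.locallyLipschitz.continuous hu
  refine ⟨convex_unitControls, fun u hu v hv a b ha hb hab => ?_⟩
  have huv := convex_unitControls hu hv ha hb hab
  simp only [smul_eq_mul]
  rw [← integral_const_mul, ← integral_const_mul,
    ← integral_add ((hint hu).const_mul a) ((hint hv).const_mul b)]
  refine integral_mono_ae (hint huv) (((hint hu).const_mul a).add ((hint hv).const_mul b)) ?_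
  filter_upwards [Lp.coeFn_add (a • u) (b • v), Lp.coeFn_smul a u, Lp.coeFn_smul b v]
    with t hadd hsmul_u hsmul_v
  rw [hadd, Pi.add_apply, hsmul_u, hsmul_v]
  exact hφ.2 (mem_univ (u t)) (mem_univ (v t)) ha hb hab

theorem continuousOn_integral_comp (hφ : ConvexOn ℝ univ φ) :
    ContinuousOn (fun u : Lp ℝ 2 μ => ∫ t, φ (u t) ∂μ) (unitControls μ) := by
  obtain ⟨L, hL⟩ := hφ.locallyLipschitz.locallyLipschitzOn.exists_lipschitzOnWith_of_compact
    (isCompact_Icc (a := (-1 : ℝ)) (b := 1))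
  have hint {u : Lp ℝ 2 μ} (hu : u ∈ unitControls μ) : Integrable (fun t => φ (u t)) μ :=
    integrable_comp_of_mem_unitControls hφ.locallyLipschitz.continuous hu
  have hdiff (u v : Lp ℝ 2 μ) : Integrable (fun t => |(u - v) t|) μ :=
    ((Lp.memLp (u - v)).integrable one_le_two).abs
  refine (LipschitzOnWith.of_dist_le_mul (K := L * ‖Lp.const 2 μ (1 : ℝ)‖₊)
    fun u hu v hv => ?_).continuousOn
  calc dist (∫ t, φ (u t) ∂μ) (∫ t, φ (v t) ∂μ) = ‖∫ t, φ (u t) - φ (v t) ∂μ‖ := by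
        rw [dist_eq_norm, integral_sub (hint hu) (hint hv)]
    _ ≤ ∫ t, L * |(u - v) t| ∂μ := by
        refine norm_integral_le_of_norm_le ((hdiff u v).const_mul L) ?_
        filter_upwards [hu, hv, Lp.coeFn_sub u v] with t hut hvt hsub
        rw [hsub, Pi.sub_apply, ← Real.dist_eq, ← dist_eq_norm]
        exact hL.dist_le_mul _ (abs_le.1 hut) _ (abs_le.1 hvt)
    _ ≤ L * (‖Lp.const 2 μ (1 : ℝ)‖ * ‖u - v‖) := by
        rw [integral_const_mul]
        gcongr
        exact integral_abs_le_norm_const_mul_norm (u - v)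
    _ = (L * ‖Lp.const 2 μ (1 : ℝ)‖₊ : NNReal) * dist u v := by
        rw [dist_eq_norm, NNReal.coe_mul, coe_nnnorm, mul_assoc]

theorem isMaxOn_integral_comp_of_ae_abs_eq_one (hφ : ConvexOn ℝ univ φ) (hφ1 : φ (-1) = φ 1)
    {u : Lp ℝ 2 μ} (hu : ∀ᵐ t ∂μ, |u t| = 1) :
    IsMaxOn (fun u : Lp ℝ 2 μ => ∫ t, φ (u t) ∂μ) (unitControls μ) u := by
  have hle {s : ℝ} (hs : |s| ≤ 1) : φ s ≤ φ 1 := by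
    have hseg : s ∈ segment ℝ (-1 : ℝ) 1 := by
      rw [segment_eq_Icc (by norm_num)]
      exact abs_le.1 hs
    simpa [hφ1] using hφ.le_on_segment (mem_univ _) (mem_univ _) hseg
  intro v hv
  refine integral_mono_ae (integrable_comp_of_mem_unitControls hφ.locallyLipschitz.continuous hv)
    (integrable_comp_of_mem_unitControls hφ.locallyLipschitz.continuous
      (hu.mono fun _ ht => ht.le)) ?_
  filter_upwards [hu, hv] with t hut hvt
  rcases eq_or_eq_neg_of_abs_eq hut with h | h <;> rw [h]
  · exact hle hvt
  · exact hφ1 ▸ hle hvt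

end IntegralCost

section MomentProblem

variable {α F : Type*} [MeasurableSpace α] {μ : Measure α} [IsFiniteMeasure μ]
  [NormedAddCommGroup F] [NormedSpace ℝ F] [CompleteSpace F]
  [FiniteDimensional ℝ F] {g : α → F} {φ : ℝ → ℝ}

theorem isLeast_optimalValue_momentMap (hg : MemLp g 2 μ) (hφ : ConvexOn ℝ univ φ) {ξ : F}
    (hξ : ξ ∈ momentMap hg '' unitControls μ) :
    IsLeast ((fun u : Lp ℝ 2 μ => ∫ t, φ (u t) ∂μ) '' (unitControls μ ∩ momentMap hg ⁻¹' {ξ}))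
      (optimalValue (unitControls μ) (momentMap hg) (fun u => ∫ t, φ (u t) ∂μ) ξ) :=
  isLeast_optimalValue_of_isBounded isClosed_unitControls isBounded_unitControls
    (convexOn_integral_comp hφ) (continuousOn_integral_comp hφ).lowerSemicontinuousOn hξ

theorem continuousOn_optimalValue_momentMap (hg : MemLp g 2 μ) (hnormal : IsNormalKernel g μ)
    (hφ : ConvexOn ℝ univ φ) (hφ1 : φ (-1) = φ 1) :
    ContinuousOn (optimalValue (unitControls μ) (momentMap hg) fun u => ∫ t, φ (u t) ∂μ)
      (momentMap hg '' unitControls μ) :=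
  continuousOn_optimalValue_of_isBounded isClosed_unitControls isBounded_unitControls
    (convexOn_integral_comp hφ) (continuousOn_integral_comp hφ).lowerSemicontinuousOn
    fun _ hu _ hf => isMaxOn_integral_comp_of_ae_abs_eq_one hφ hφ1
      (ae_abs_eq_one_of_isProperSupport hg hnormal hu hf)

end MomentProblem

section ProductRule

variable {a b : ℝ}

theorem mul_eq_mul_add_integral {p p' q g : ℝ → ℝ} (hp : ∀ t, HasDerivAt p (p' t) t)
    (hp' : Continuous p') (hg : IntervalIntegrable g volume a b)
    (hq : ∀ t ∈ uIcc a b, q t = q a + ∫ s in a..t, g s) :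
    p b * q b = p a * q a + ∫ s in a..b, (p' s * q s + p s * g s) := by
  have hderiv : deriv p = p' := funext fun s => (hp s).deriv
  have hp1 : ContDiff ℝ 1 p :=
    contDiff_one_iff_deriv.2 ⟨fun s => (hp s).differentiableAt, hderiv ▸ hp'⟩
  have hpac : AbsolutelyContinuousOnInterval p a b :=
    hp1.contDiffOn.absolutelyContinuousOnInterval
  have hgac : AbsolutelyContinuousOnInterval (fun t => ∫ s in a..t, g s) a b :=
    hg.absolutelyContinuousOnInterval_intervalIntegral left_mem_uIcc
  have hcac : AbsolutelyContinuousOnInterval (fun _ => q a) a b :=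
    (contDiff_const (n := 1)).contDiffOn.absolutelyContinuousOnInterval
  have hparts := hpac.integral_deriv_mul_eq_sub (hcac.fun_add hgac)
  have hintegrand : ∫ s in a..b, (p' s * q s + p s * g s) =
      ∫ s in a..b, (deriv p s * (q a + ∫ r in a..s, g r) +
        p s * deriv (fun t => q a + ∫ r in a..t, g r) s) := by
    refine intervalIntegral.integral_congr_ae ?_
    filter_upwards [hg.ae_hasDerivAt_integral] with s hs hsab
    have hsab' := uIoc_subset_uIcc hsab
    rw [hderiv, ((hs hsab' a left_mem_uIcc).const_add (q a)).deriv, ← hq s hsab']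
  rw [hintegrand, hparts, ← hq b right_mem_uIcc, ← hq a left_mem_uIcc, add_sub_cancel]

theorem intervalIntegral_apply {ι : Type*} [Fintype ι] {f : ℝ → ι → ℝ}
    (hf : ∀ i, IntervalIntegrable (f · i) volume a b) (i : ι) :
    (∫ s in a..b, f s) i = ∫ s in a..b, f s i := by
  rw [intervalIntegral, Pi.sub_apply, eval_integral fun i => (hf i).1,
    eval_integral fun i => (hf i).2, intervalIntegral]

theorem mulVec_eq_mulVec_add_integral {l m : Type*} [Fintype l] [Fintype m]
    {M M' : ℝ → Matrix l m ℝ} {v g : ℝ → m → ℝ}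
    (hM : ∀ i j t, HasDerivAt (fun s => M s i j) (M' t i j) t) (hM' : Continuous M')
    (hg : IntervalIntegrable g volume a b)
    (hv : ∀ t ∈ uIcc a b, v t = v a + ∫ s in a..t, g s) :
    M b *ᵥ v b = M a *ᵥ v a + ∫ s in a..b, (M' s *ᵥ v s + M s *ᵥ g s) := by
  have hgj (j : m) {t : ℝ} (ht : t ∈ uIcc a b) : IntervalIntegrable (g · j) volume a t := by
    have hgt := hg.mono_set (uIcc_subset_uIcc_left ht)
    exact ⟨hgt.1.eval j, hgt.2.eval j⟩
  have hvj (j : m) : ∀ t ∈ uIcc a b, v t j = v a j + ∫ s in a..t, g s j := fun t ht => by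
    rw [hv t ht, Pi.add_apply, intervalIntegral_apply fun j => hgj j ht]
  have hvcont (j : m) : ContinuousOn (v · j) (uIcc a b) :=
    (continuousOn_const.add (intervalIntegral.continuousOn_primitive_interval'
      (hgj j right_mem_uIcc) left_mem_uIcc)).congr (hvj j)
  have hint (i : l) (j : m) :
      IntervalIntegrable (fun s => M' s i j * v s j + M s i j * g s j) volume a b := by
    have hMc : Continuous fun s => M s i j :=
      continuous_iff_continuousAt.2 fun t => (hM i j t).continuousAt
    exact ((hM'.matrix_elem i j).continuousOn.mul (hvcont j)).intervalIntegrable.add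
      ((hgj j right_mem_uIcc).continuousOn_mul hMc.continuousOn)
  have hentry (s : ℝ) (i : l) : (M' s *ᵥ v s + M s *ᵥ g s) i =
      ∑ j, (M' s i j * v s j + M s i j * g s j) := Finset.sum_add_distrib.symm
  ext i
  rw [Pi.add_apply, intervalIntegral_apply fun i => by
    simpa only [hentry, Finset.sum_fn] using
      IntervalIntegrable.sum Finset.univ fun j _ => hint i j]
  simp only [hentry]
  rw [intervalIntegral.integral_finsetSum fun j _ => hint i j]
  simp only [Matrix.mulVec, dotProduct]
  rw [← Finset.sum_add_distrib]
  exact Finset.sum_congr rfl fun j _ => mul_eq_mul_add_integral (hM i j) (hM'.matrix_elem i j)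
    (hgj j right_mem_uIcc) (hvj j)

end ProductRule

section MatrixExponential

variable {m : Type*} [Fintype m] [DecidableEq m] (A : Matrix m m ℝ)

section

attribute [local instance] Matrix.linftyOpNormedRing Matrix.linftyOpNormedAlgebra

theorem hasDerivAt_exp_smul_apply (i j : m) (t : ℝ) :
    HasDerivAt (fun s : ℝ => NormedSpace.exp (s • A) i j) ((NormedSpace.exp (t • A) * A) i j) t :=
  ((Matrix.entryLinearMap ℝ ℝ i j).toContinuousLinearMap.hasFDerivAt.comp_hasDerivAt t
    (hasDerivAt_exp_smul_const (𝕂 := ℝ) A t) :)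

theorem analyticOnNhd_exp_smul_apply (i j : m) :
    AnalyticOnNhd ℝ (fun t : ℝ => NormedSpace.exp (t • A) i j) univ := fun t _ =>
  have hexp : AnalyticAt ℝ (fun s : ℝ => NormedSpace.exp (s • A)) t :=
    AnalyticAt.fun_comp (f := fun s : ℝ => s • A) (NormedSpace.exp_analytic (𝕂 := ℝ) (t • A))
      (analyticAt_id.smul analyticAt_const)
  ((Matrix.entryLinearMap ℝ ℝ i j).toContinuousLinearMap.analyticAt _).fun_comp hexp

end

theorem continuous_exp_smul : Continuous fun t : ℝ => NormedSpace.exp (t • A) :=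
  continuous_matrix fun i j =>
    continuous_iff_continuousAt.2 fun t => (hasDerivAt_exp_smul_apply A i j t).continuousAt

theorem commute_exp_smul (t : ℝ) : Commute (NormedSpace.exp (t • A)) A :=
  ((Commute.refl A).smul_left t).exp_left

theorem exp_mul_exp_neg : NormedSpace.exp A * NormedSpace.exp (-A) = 1 := by
  rw [← Matrix.exp_add_of_commute _ _ (Commute.refl A).neg_right, add_neg_cancel,
    NormedSpace.exp_zero]

end MatrixExponential

section SteeringToOrigin

variable {n : ℕ} {A : Matrix (Fin n) (Fin n) ℝ} {B : Fin n → ℝ}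

/-- The kernel `t ↦ -e^{-tA} B`. Its integral against a control is the initial state which that
control steers to the origin, whence the sign. -/
noncomputable def steeringKernel (A : Matrix (Fin n) (Fin n) ℝ) (B : Fin n → ℝ) (t : ℝ) :
    Fin n → ℝ :=
  -(NormedSpace.exp (-(t • A)) *ᵥ B)

theorem continuous_exp_neg_smul_mulVec :
    Continuous fun t : ℝ => NormedSpace.exp (-(t • A)) *ᵥ B := by
  simp only [← smul_neg]
  exact (continuous_exp_smul (-A)).matrix_mulVec continuous_const

theorem continuous_steeringKernel : Continuous (steeringKernel A B) :=
  continuous_exp_neg_smul_mulVec.neg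

theorem integral_smul_steeringKernel (u : ℝ → ℝ) (a b : ℝ) :
    ∫ s in a..b, u s • steeringKernel A B s =
      -∫ s in a..b, u s • (NormedSpace.exp (-(s • A)) *ᵥ B) := by
  simp only [steeringKernel, smul_neg, intervalIntegral.integral_neg]

theorem IsTrajectory.exp_neg_smul_mulVec {τ : ℝ} {u : ℝ → ℝ} {x : ℝ → Fin n → ℝ}
    (hx : IsTrajectory A B τ u x) (hτ : 0 ≤ τ) :
    NormedSpace.exp (-(τ • A)) *ᵥ x τ =
      x 0 + ∫ s in (0 : ℝ)..τ, u s • (NormedSpace.exp (-(s • A)) *ᵥ B) := by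
  obtain ⟨hu, hxc, hxe⟩ := hx
  rw [← uIcc_of_le hτ] at hxc hxe
  have hvel : IntervalIntegrable (fun s => A *ᵥ x s + u s • B) volume 0 τ :=
    ((Continuous.matrix_mulVec continuous_const continuous_id).comp_continuousOn
      hxc).intervalIntegrable.add (hu.smul_continuousOn continuousOn_const)
  have hmul := mulVec_eq_mulVec_add_integral (hasDerivAt_exp_smul_apply (-A))
    ((continuous_exp_smul (-A)).mul continuous_const) hvel hxe
  simpa only [smul_neg, zero_smul, neg_zero, NormedSpace.exp_zero, Matrix.one_mulVec, mul_neg,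
    Matrix.neg_mulVec, Matrix.mulVec_add, Matrix.mulVec_mulVec, Matrix.mulVec_smul,
    neg_add_cancel_left] using hmul

theorem exists_isTrajectory {τ : ℝ} (hτ : 0 ≤ τ) {u : ℝ → ℝ}
    (hu : IntervalIntegrable u volume 0 τ) (ξ : Fin n → ℝ) :
    ∃ x : ℝ → Fin n → ℝ, IsTrajectory A B τ u x ∧ x 0 = ξ := by
  set g : ℝ → Fin n → ℝ := fun s => u s • (NormedSpace.exp (-(s • A)) *ᵥ B)
  set y : ℝ → Fin n → ℝ := fun t => ξ + ∫ s in (0 : ℝ)..t, g s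
  have hy0 : y 0 = ξ := by simp [y]
  have hg : IntervalIntegrable g volume 0 τ :=
    hu.smul_continuousOn continuous_exp_neg_smul_mulVec.continuousOn
  have hyc : ContinuousOn y (Icc 0 τ) := by
    rw [← uIcc_of_le hτ]
    exact continuousOn_const.add
      (intervalIntegral.continuousOn_primitive_interval' hg left_mem_uIcc)
  have hx0 : NormedSpace.exp ((0 : ℝ) • A) *ᵥ y 0 = ξ := by
    rw [zero_smul, NormedSpace.exp_zero, Matrix.one_mulVec, hy0]
  refine ⟨fun t => NormedSpace.exp (t • A) *ᵥ y t, ⟨hu, ?_, fun t ht => ?_⟩, hx0⟩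
  · exact (continuous_fst.matrix_mulVec continuous_snd).comp_continuousOn
      ((continuous_exp_smul A).continuousOn.prodMk hyc)
  have hgt : IntervalIntegrable g volume 0 t :=
    hg.mono_set (uIcc_subset_uIcc_left (by rwa [uIcc_of_le hτ]))
  have hvel (s : ℝ) : A *ᵥ (NormedSpace.exp (s • A) *ᵥ y s) + u s • B =
      (NormedSpace.exp (s • A) * A) *ᵥ y s + NormedSpace.exp (s • A) *ᵥ g s := by
    rw [(commute_exp_smul A s).eq, Matrix.mulVec_mulVec, Matrix.mulVec_smul, Matrix.mulVec_mulVec,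
      exp_mul_exp_neg, Matrix.one_mulVec]
  simp only [hvel]
  exact mulVec_eq_mulVec_add_integral (hasDerivAt_exp_smul_apply A)
    ((continuous_exp_smul A).mul continuous_const) hgt fun s _ => by rw [hy0]

theorem exists_isTrajectory_to_zero_iff {τ : ℝ} (hτ : 0 ≤ τ) {u : ℝ → ℝ}
    (hu : IntervalIntegrable u volume 0 τ) {ξ : Fin n → ℝ} :
    (∃ x : ℝ → Fin n → ℝ, IsTrajectory A B τ u x ∧ x 0 = ξ ∧ x τ = 0) ↔
      ∫ s in (0 : ℝ)..τ, u s • steeringKernel A B s = ξ := by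
  rw [integral_smul_steeringKernel, neg_eq_iff_add_eq_zero, add_comm]
  constructor
  · rintro ⟨x, hx, rfl, hxτ⟩
    rw [← hx.exp_neg_smul_mulVec hτ, hxτ, Matrix.mulVec_zero]
  · intro h
    obtain ⟨x, hx, rfl⟩ := exists_isTrajectory (A := A) (B := B) hτ hu ξ
    rw [← hx.exp_neg_smul_mulVec hτ] at h
    refine ⟨x, hx, rfl, Matrix.mulVec_injective_of_isUnit (Matrix.isUnit_exp (-(τ • A))) ?_⟩
    rw [h, Matrix.mulVec_zero]

theorem isNormalKernel_steeringKernel (s : Set ℝ) :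
    IsNormalKernel (steeringKernel A B) (volume.restrict s) := by
  intro f
  by_cases hzero : ∀ t, f (steeringKernel A B t) = 0
  · exact Or.inl (Filter.Eventually.of_forall hzero)
  push Not at hzero
  obtain ⟨t₀, ht₀⟩ := hzero
  have hanalytic : AnalyticOnNhd ℝ (fun t => f (steeringKernel A B t)) univ := fun t _ => by
    refine (f.analyticAt _).fun_comp (AnalyticAt.fun_neg (AnalyticAt.pi fun i => ?_))
    simp only [Matrix.mulVec, dotProduct, ← smul_neg]
    exact Finset.univ.analyticAt_fun_sum fun j _ =>
      (analyticOnNhd_exp_smul_apply (-A) i j t trivial).mul analyticAt_const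
  have hne := ae_restrict_le_codiscreteWithin (μ := (volume : Measure ℝ)) MeasurableSet.univ
    (hanalytic.preimage_zero_mem_codiscrete ht₀)
  rw [Measure.restrict_univ] at hne
  exact Or.inr (ae_restrict_of_ae hne)

end SteeringToOrigin

section FeasibleControls

variable {n : ℕ} {A : Matrix (Fin n) (Fin n) ℝ} {B : Fin n → ℝ} {T : ℝ}

theorem intervalIntegral_eq_integral_Icc {F : Type*} [NormedAddCommGroup F] [NormedSpace ℝ F]
    (hT : 0 ≤ T) (f : ℝ → F) :
    ∫ t in (0 : ℝ)..T, f t = ∫ t, f t ∂volume.restrict (Icc 0 T) := by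
  rw [intervalIntegral.integral_of_le hT, integral_Icc_eq_integral_Ioc]

theorem mem_admissibleControls_iff {u : ℝ → ℝ} :
    u ∈ admissibleControls T ↔
      ∃ v ∈ unitControls (volume.restrict (Icc 0 T)), v =ᵐ[volume.restrict (Icc 0 T)] u := by
  constructor
  · rintro ⟨hu, hnorm⟩
    refine exists_mem_unitControls_ae_eq hu ?_
    rw [eLpNorm_exponent_top] at hnorm
    filter_upwards [ae_le_eLpNormEssSup (f := u) (μ := volume.restrict (Icc 0 T))] with t ht
    have hle := ht.trans hnorm
    rwa [← ofReal_norm, ENNReal.ofReal_le_one] at hle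
  · rintro ⟨v, hv, hvu⟩
    refine ⟨(Lp.aestronglyMeasurable v).congr hvu, ?_⟩
    rw [← eLpNorm_congr_ae hvu, eLpNorm_exponent_top]
    simpa using eLpNormEssSup_le_of_ae_bound (f := v) (C := 1) hv

theorem intervalIntegrable_of_ae_eq (hT : 0 ≤ T) {u : ℝ → ℝ}
    {v : Lp ℝ 2 (volume.restrict (Icc 0 T))} (hvu : v =ᵐ[volume.restrict (Icc 0 T)] u) :
    IntervalIntegrable u volume 0 T :=
  (intervalIntegrable_iff_integrableOn_Icc_of_le hT).2
    (((Lp.memLp v).integrable one_le_two).congr hvu)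

theorem memLp_steeringKernel : MemLp (steeringKernel A B) 2 (volume.restrict (Icc 0 T)) := by
  have hcont : Continuous (steeringKernel A B) := continuous_steeringKernel
  obtain ⟨c, hc⟩ := isCompact_Icc.exists_bound_of_continuousOn (s := Icc 0 T) hcont.continuousOn
  exact MemLp.of_bound hcont.aestronglyMeasurable c
    ((ae_restrict_iff' measurableSet_Icc).2 (Filter.Eventually.of_forall hc))

/-- The continuous linear map taking a square-integrable control on `[0, T]` to the initial state
which it steers to the origin. -/
noncomputable def steeringMap (A : Matrix (Fin n) (Fin n) ℝ) (B : Fin n → ℝ) (T : ℝ) :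
    Lp ℝ 2 (volume.restrict (Icc 0 T)) →L[ℝ] Fin n → ℝ :=
  momentMap (memLp_steeringKernel (A := A) (B := B))

theorem steeringMap_eq_intervalIntegral (hT : 0 ≤ T) {u : ℝ → ℝ}
    {v : Lp ℝ 2 (volume.restrict (Icc 0 T))} (hvu : v =ᵐ[volume.restrict (Icc 0 T)] u) :
    steeringMap A B T v = ∫ t in (0 : ℝ)..T, u t • steeringKernel A B t := by
  rw [steeringMap, momentMap_apply, intervalIntegral_eq_integral_Icc hT]
  refine integral_congr_ae ?_
  filter_upwards [hvu] with t ht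
  rw [ht]

theorem mem_feasibleControls_iff (hT : 0 ≤ T) {ξ : Fin n → ℝ} {u : ℝ → ℝ} :
    u ∈ feasibleControls A B T ξ ↔
      ∃ v ∈ unitControls (volume.restrict (Icc 0 T)) ∩ steeringMap A B T ⁻¹' {ξ},
        v =ᵐ[volume.restrict (Icc 0 T)] u := by
  rw [feasibleControls, mem_ofPred_eq, mem_admissibleControls_iff]
  constructor
  · rintro ⟨⟨v, hv, hvu⟩, hx⟩
    rw [exists_isTrajectory_to_zero_iff hT (intervalIntegrable_of_ae_eq hT hvu)] at hx
    exact ⟨v, ⟨hv, (steeringMap_eq_intervalIntegral hT hvu).trans hx⟩, hvu⟩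
  · rintro ⟨v, ⟨hv, hvξ⟩, hvu⟩
    rw [exists_isTrajectory_to_zero_iff hT (intervalIntegrable_of_ae_eq hT hvu)]
    exact ⟨⟨v, hv, hvu⟩, (steeringMap_eq_intervalIntegral hT hvu).symm.trans hvξ⟩

theorem reachableSet_eq_image_steeringMap (hT : 0 ≤ T) :
    reachableSet A B T = steeringMap A B T '' unitControls (volume.restrict (Icc 0 T)) := by
  have hneg {v : Lp ℝ 2 (volume.restrict (Icc 0 T))} {u : ℝ → ℝ}
      (hvu : v =ᵐ[volume.restrict (Icc 0 T)] u) : steeringMap A B T (-v) =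
        ∫ t in (0 : ℝ)..T, u t • (NormedSpace.exp (-(t • A)) *ᵥ B) := by
    rw [map_neg, steeringMap_eq_intervalIntegral hT hvu, integral_smul_steeringKernel, neg_neg]
  ext ξ
  constructor
  · rintro ⟨u, hu, rfl⟩
    obtain ⟨v, hv, hvu⟩ := mem_admissibleControls_iff.1 hu
    exact ⟨-v, neg_mem_unitControls hv, hneg hvu⟩
  · rintro ⟨v, hv, rfl⟩
    refine ⟨_, mem_admissibleControls_iff.2 ⟨-v, neg_mem_unitControls hv, .rfl⟩, ?_⟩
    rw [← hneg .rfl, neg_neg]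

end FeasibleControls

section SumOfAbsoluteValues

variable {N : ℕ} {U w : Fin N → ℝ} {T : ℝ}

/-- The running cost `∑ᵢ wᵢ (|s - Uᵢ| + |s + Uᵢ|)`, whose integral along a control is the
sum-of-absolute-values cost. -/
noncomputable def soavIntegrand (U w : Fin N → ℝ) (s : ℝ) : ℝ :=
  ∑ i, w i * (|s - U i| + |s + U i|)

theorem soavIntegrand_neg (s : ℝ) : soavIntegrand U w (-s) = soavIntegrand U w s := by
  refine Finset.sum_congr rfl fun i _ => ?_
  rw [← neg_add', abs_neg, neg_add_eq_sub, abs_sub_comm, add_comm]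

theorem convexOn_soavIntegrand (hw : ∀ i, 0 ≤ w i) : ConvexOn ℝ univ (soavIntegrand U w) := by
  have hterm (i : Fin N) : ConvexOn ℝ univ fun s => w i • (|s - U i| + |s + U i|) := by
    have hdist := ((convexOn_univ_dist (U i)).add (convexOn_univ_dist (-U i))).smul (hw i)
    simpa only [Real.dist_eq, sub_neg_eq_add, Pi.add_apply] using hdist
  refine ⟨convex_univ, fun s _ t _ a b ha hb hab => ?_⟩
  simp only [soavIntegrand, Finset.smul_sum, ← Finset.sum_add_distrib]
  exact Finset.sum_le_sum fun i _ => (hterm i).2 trivial trivial ha hb hab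

theorem soavCost_eq_integral (hT : 0 ≤ T) {u : ℝ → ℝ}
    (hu : Integrable u (volume.restrict (Icc 0 T))) :
    soavCost U w T u = ∫ t in Icc 0 T, soavIntegrand U w (u t) := by
  have hsub (i : Fin N) : Integrable (fun t => |u t - U i|) (volume.restrict (Icc 0 T)) :=
    (hu.sub (integrable_const (U i))).abs
  have hadd (i : Fin N) : Integrable (fun t => |u t + U i|) (volume.restrict (Icc 0 T)) :=
    (hu.add (integrable_const (U i))).abs
  have hterm (i : Fin N) : Integrable (fun t => w i * (|u t - U i| + |u t + U i|))
      (volume.restrict (Icc 0 T)) := ((hsub i).add (hadd i)).const_mul (w i)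
  simp only [soavIntegrand]
  rw [integral_finsetSum _ fun i _ => hterm i]
  refine Finset.sum_congr rfl fun i _ => ?_
  rw [integral_const_mul, integral_add (hsub i) (hadd i), l1Norm, l1Norm,
    intervalIntegral_eq_integral_Icc hT, intervalIntegral_eq_integral_Icc hT]

theorem soavCost_eq_integral_of_ae_eq (hT : 0 ≤ T) {u : ℝ → ℝ}
    {v : Lp ℝ 2 (volume.restrict (Icc 0 T))} (hvu : v =ᵐ[volume.restrict (Icc 0 T)] u) :
    soavCost U w T u = ∫ t in Icc 0 T, soavIntegrand U w (v t) := by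
  rw [soavCost_eq_integral hT (((Lp.memLp v).integrable one_le_two).congr hvu)]
  refine integral_congr_ae ?_
  filter_upwards [hvu] with t ht
  rw [ht]

variable {n : ℕ} {A : Matrix (Fin n) (Fin n) ℝ} {B : Fin n → ℝ}

theorem image_soavCost_feasibleControls (hT : 0 ≤ T) (ξ : Fin n → ℝ) :
    soavCost U w T '' feasibleControls A B T ξ =
      (fun v : Lp ℝ 2 (volume.restrict (Icc 0 T)) => ∫ t in Icc 0 T, soavIntegrand U w (v t)) ''
        (unitControls (volume.restrict (Icc 0 T)) ∩ steeringMap A B T ⁻¹' {ξ}) := by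
  ext c
  constructor
  · rintro ⟨u, hu, rfl⟩
    obtain ⟨v, hv, hvu⟩ := (mem_feasibleControls_iff hT).1 hu
    exact ⟨v, hv, (soavCost_eq_integral_of_ae_eq hT hvu).symm⟩
  · rintro ⟨v, hv, rfl⟩
    exact ⟨v, (mem_feasibleControls_iff hT).2 ⟨v, hv, .rfl⟩, soavCost_eq_integral_of_ae_eq hT .rfl⟩

theorem valueFunction_eq_optimalValue (hT : 0 ≤ T) :
    valueFunction A B U w T = optimalValue (unitControls (volume.restrict (Icc 0 T)))
      (steeringMap A B T) fun v => ∫ t in Icc 0 T, soavIntegrand U w (v t) :=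
  funext fun ξ => congrArg sInf (image_soavCost_feasibleControls hT ξ)

end SumOfAbsoluteValues

theorem theorem5_general {n N : ℕ} (A : Matrix (Fin n) (Fin n) ℝ) (B : Fin n → ℝ) {T : ℝ}
    (hT : 0 ≤ T) (U w : Fin N → ℝ) (hw : ∀ i, 0 ≤ w i) :
    (∀ ξ ∈ reachableSet A B T,
      IsLeast (soavCost U w T '' feasibleControls A B T ξ) (valueFunction A B U w T ξ)) ∧
    ContinuousOn (valueFunction A B U w T) (reachableSet A B T) := by
  have hconvex : ConvexOn ℝ univ (soavIntegrand U w) := convexOn_soavIntegrand hw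
  rw [reachableSet_eq_image_steeringMap hT, valueFunction_eq_optimalValue hT]
  refine ⟨fun ξ hξ => ?_, ?_⟩
  · rw [image_soavCost_feasibleControls hT]
    exact isLeast_optimalValue_momentMap memLp_steeringKernel hconvex hξ
  · exact continuousOn_optimalValue_momentMap memLp_steeringKernel
      (isNormalKernel_steeringKernel (Icc 0 T)) hconvex (soavIntegrand_neg 1)

theorem theorem5 {n : ℕ} (A : Matrix (Fin n) (Fin n) ℝ) (B : Fin n → ℝ)
    (T : ℝ) (hT : 0 < T)
    {N : ℕ} (hN : 0 < N) (U w : Fin N → ℝ)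
    (hU_mono : StrictMono U) (hU_nonneg : 0 ≤ U ⟨0, hN⟩)
    (hU_last : U ⟨N - 1, Nat.sub_lt hN Nat.one_pos⟩ = 1)
    (hw_nonneg : ∀ i, 0 ≤ w i) (hw_sum : ∑ i, w i = 1)
    (hAB : Controllable A B) :
    (∀ ξ ∈ reachableSet A B T,
      IsLeast (soavCost U w T '' feasibleControls A B T ξ) (valueFunction A B U w T ξ)) ∧
    ContinuousOn (valueFunction A B U w T) (reachableSet A B T) :=
  theorem5_general A B hT.le U w hw_nonneg
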